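/- Let $n\ge1$ be an integer, let $0<|q|<1$ ($q\in\mathbb C$), write $(z)_k=\prod_{i=0}^{k-1}(1-zq^i)$ and $(z,w)_k=(z)_k(w)_k$ for nonnegative integers $k$, $|\boldsymbol k|=k_1+\cdots+k_n$ for $\boldsymbol k=(k_1,\dots,k_n)\in\mathbb Z_{\ge0}^n$, $q^{\boldsymbol k}=(q^{k_1},\dots,q^{k_n})$, and $Y=y_1y_2\cdots y_n$ for $\boldsymbol y=(y_1,\dots,y_n)\in\mathbb C^n$. Let $x_1,\dots,x_n,a,b\in\mathbb C$ be such that $x_r\neq0$ for all $r$, $x_r/x_s\notin\{q^i:i\in\mathbb Z\}$ for $r\ne s$, and $aq^i\neq1$, $bq^i\ne1$ for all integers $i\geq0$. Let $K:\mathbb C^n\to\mathbb C$ be any function and let $\beta(\boldsymbol j)\in\mathbb C$ $(\boldsymbol j\in\mathbb Z_{\ge0}^n)$ be any coefficients. Consider the identity $$ \begin{aligned} & K(\boldsymbol y)\sum_{\boldsymbol j\in\mathbb Z_{\ge0}^n}\ \prod_{1\le r<s\le n}\frac{1-q^{j_r-j_s}x_r/x_s}{1-x_r/x_s}\prod_{r,s=1}^n\Big(\frac{x_r}{x_sy_s}\Big)_{j_r}\,\frac{1-bq^{2|\boldsymbol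 j|}}{(1-b)(bqY)_{|\boldsymbol j|}}\,Y^{|\boldsymbol j|}q^{\sum_{r=1}^n(r-1)j_r}\beta(\boldsymbol j)\\ &=\sum_{\boldsymbol k\in\mathbb Z_{\ge0}^n}\ \prod_{1\le r<s\le n}\frac{1-q^{k_r-k_s}x_r/x_s}{1-x_r/x_s}\prod_{r,s=1}^n\frac{(x_r/(x_sy_s))_{k_r}}{(qx_r/x_s)_{k_r}}\,\frac{(1-aq^{2|\boldsymbol k|})(a)_{|\boldsymbol k|}}{(1-a)(aqY)_{|\boldsymbol k|}}\,Y^{|\boldsymbol k|}q^{\sum_{r=1}^n(r-1)k_r}\\ &\quad\times\sum_{\substack{0\le j_r\le k_r\\ r=1,\dots,n}}\ \prod_{1\le r<s\le n}\frac{1-q^{j_r-j_s}x_r/x_s}{1-x_r/x_s}\prod_{r,s=1}^n(q^{-k_s}x_r/x_s)_{j_r}\,\frac{(aq^{|\boldsymbol k|},bq)_{|\boldsymbol j|}}{(b)_{2|\boldsymbol j|}}(-1)^{|\boldsymbol j|}q^{\sum_{r=1}^n rj_r+\binom{|\boldsymbol j|}{2}}\beta(\boldsymbol j)\\ &\quad\times\sum_{\substack{0\le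 m_r\le k_r-j_r\\ r=1,\dots,n}}\ \prod_{1\le r<s\le n}\frac{1-q^{m_r-m_s+j_r-j_s}x_r/x_s}{1-q^{j_r-j_s}x_r/x_s}\,q^{\sum_{r=1}^n rm_r}K(q^{\boldsymbol m+\boldsymbol j})\\ &\qquad\times\prod_{r,s=1}^n\frac{(q^{-k_s+j_r}x_r/x_s)_{m_r}}{(q^{1+j_r-j_s}x_r/x_s)_{m_r}}\,\frac{(aq^{|\boldsymbol k|+|\boldsymbol j|},bq^{1+|\boldsymbol j|})_{|\boldsymbol m|}}{(aq)_{|\boldsymbol m|+|\boldsymbol j|}(bq^{2|\boldsymbol j|+1})_{|\boldsymbol m|}}, \end{aligned} \tag{$*$} $$ where at points with some $y_s=0$ the product $Y^{|\boldsymbol k|}\prod_{r,s}(x_r/(x_sy_s))_{k_r}$ is read as the polynomial $\prod_{r,s=1}^n\prod_{i=0}^{k_r-1}(y_s-q^ix_r/x_s)$, with which it coincides when all $y_s\ne0$. (i) For all nonnegative integers $N_1,\dots,N_n$, the series on both sides of $(*)$ terminate at $\boldsymbol y=q^{\boldsymbol N}$ (their terms with index $\boldsymbol j$, resp. $\boldsymbol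 k$, vanish unless $j_r\le N_r$, resp. $k_r\leq N_r$, for all $r$), and $(*)$ holds at $\boldsymbol y=q^{\boldsymbol N}$. (ii) Let $R_1,\dots,R_n>0$ and $D=\{\boldsymbol y\in\mathbb C^n:|y_r|<R_r \text{ for } r=1,\dots,n\}$. Suppose that $aq^{i}Y\neq1$ and $bq^{i}Y\ne1$ for all $\boldsymbol y\in D$ and all integers $i\ge1$ (so that no denominator in $(*)$ vanishes), that the series over $\boldsymbol j$ on the left and the series over $\boldsymbol k$ on the right of $(*)$ converge absolutely for each $\boldsymbol y\in D$, and that both sides of $(*)$ are analytic functions of $\boldsymbol y$ on $D$. Then $(*)$ holds for all $\boldsymbol y\in D$. -/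

import Mathlib

open Finset

namespace AnSeries

noncomputable section

/-- The `q`-shifted factorial `(z; q)_k = ∏_{i < k} (1 - z q^i)` for a nonnegative integer `k`. -/
def qPoch (q z : ℂ) (k : ℕ) : ℂ := ∏ i ∈ range k, (1 - z * q ^ i)

/-- `|k| = k_1 + ⋯ + k_n`. -/
def wt {n : ℕ} (k : Fin n → ℕ) : ℕ := ∑ r, k r

/-- The point `q^N = (q^{N_1}, …, q^{N_n})`. -/
def qPoint {n : ℕ} (q : ℂ) (N : Fin n → ℕ) : Fin n → ℂ := fun r => q ^ N r

/-- `∏_{1 ≤ r < s ≤ n} (1 - q^{k_r - k_s} x_r / x_s) / (1 - x_r / x_s)`. -/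
def vandermonde {n : ℕ} (q : ℂ) (x : Fin n → ℂ) (k : Fin n → ℕ) : ℂ :=
  ∏ r : Fin n, ∏ s ∈ Ioi r,
    (1 - q ^ ((k r : ℤ) - (k s : ℤ)) * (x r / x s)) / (1 - x r / x s)

/-- `q^{∑_{r=1}^n (r - 1) k_r}` (the index `r : Fin n` starts at `0`). -/
def qShift {n : ℕ} (q : ℂ) (k : Fin n → ℕ) : ℂ := q ^ (∑ r : Fin n, (r : ℕ) * k r)

/-- `q^{∑_{r=1}^n r k_r}` (the index `r : Fin n` starts at `0`). -/
def qShiftSucc {n : ℕ} (q : ℂ) (k : Fin n → ℕ) : ℂ := q ^ (∑ r : Fin n, ((r : ℕ) + 1) * k r)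

/-- The function of `y` given by
`(y_1 ⋯ y_n)^{|k|} ∏_{r,s=1}^n (x_r / (x_s y_s))_{k_r}` where all `y_s ≠ 0` (see `yFactor_eq`),
with its removable singularities at `y_s = 0` filled in: it is the polynomial
`∏_{r,s=1}^n ∏_{i < k_r} (y_s - q^i x_r / x_s)`. -/
def yFactor {n : ℕ} (q : ℂ) (x y : Fin n → ℂ) (k : Fin n → ℕ) : ℂ :=
  ∏ r : Fin n, ∏ s : Fin n, ∏ i ∈ range (k r), (y s - q ^ i * (x r / x s))

theorem yFactor_eq {n : ℕ} (q : ℂ) (x y : Fin n → ℂ) (k : Fin n → ℕ) (hy : ∀ s, y s ≠ 0) :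
    yFactor q x y k =
      (∏ r : Fin n, ∏ s : Fin n, qPoch q (x r / (x s * y s)) (k r)) * (∏ s, y s) ^ wt k := by
  unfold yFactor qPoch wt
  rw [← Finset.prod_pow_eq_pow_sum, ← Finset.prod_mul_distrib]
  refine Finset.prod_congr rfl fun r _ => ?_
  rw [← Finset.prod_pow, ← Finset.prod_mul_distrib]
  refine Finset.prod_congr rfl fun s _ => ?_
  rw [← Finset.card_range (k r), ← Finset.prod_const, Finset.card_range,
    ← Finset.prod_mul_distrib]
  refine Finset.prod_congr rfl fun i _ => ?_
  have h := hy s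
  rw [← div_div]
  field_simp

/-- The term with index `j` of the series on the left-hand side. -/
def lhsTerm {n : ℕ} (q : ℂ) (x : Fin n → ℂ) (b : ℂ) (β : (Fin n → ℕ) → ℂ)
    (y : Fin n → ℂ) (j : Fin n → ℕ) : ℂ :=
  vandermonde q x j * yFactor q x y j
    * ((1 - b * q ^ (2 * wt j)) / ((1 - b) * qPoch q (b * q * ∏ r, y r) (wt j)))
    * qShift q j * β j

/-- The innermost sum, over `0 ≤ m_r ≤ k_r - j_r`, of the right-hand side (here `j ≤ k`). -/
def innerSum {n : ℕ} (q : ℂ) (x : Fin n → ℂ) (a b : ℂ) (K : (Fin n → ℂ) → ℂ)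
    (k j : Fin n → ℕ) : ℂ :=
  ∑ m ∈ Icc 0 (k - j),
    (∏ r : Fin n, ∏ s ∈ Ioi r,
      (1 - q ^ ((m r : ℤ) - (m s : ℤ) + (j r : ℤ) - (j s : ℤ)) * (x r / x s)) /
        (1 - q ^ ((j r : ℤ) - (j s : ℤ)) * (x r / x s)))
    * qShiftSucc q m * K (qPoint q (m + j))
    * (∏ r : Fin n, ∏ s : Fin n,
      qPoch q (q ^ (-(k s : ℤ) + (j r : ℤ)) * (x r / x s)) (m r) /
        qPoch q (q ^ (1 + (j r : ℤ) - (j s : ℤ)) * (x r / x s)) (m r))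
    * (qPoch q (a * q ^ (wt k + wt j)) (wt m) * qPoch q (b * q ^ (1 + wt j)) (wt m) /
        (qPoch q (a * q) (wt m + wt j) * qPoch q (b * q ^ (2 * wt j + 1)) (wt m)))

/-- The middle sum, over `0 ≤ j_r ≤ k_r`, of the right-hand side. -/
def middleSum {n : ℕ} (q : ℂ) (x : Fin n → ℂ) (a b : ℂ) (K : (Fin n → ℂ) → ℂ)
    (β : (Fin n → ℕ) → ℂ) (k : Fin n → ℕ) : ℂ :=
  ∑ j ∈ Icc 0 k,
    vandermonde q x j
    * (∏ r : Fin n, ∏ s : Fin n, qPoch q (q ^ (-(k s : ℤ)) * (x r / x s)) (j r))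
    * (qPoch q (a * q ^ wt k) (wt j) * qPoch q (b * q) (wt j) / qPoch q b (2 * wt j))
    * (-1) ^ wt j * qShiftSucc q j * q ^ (wt j).choose 2 * β j
    * innerSum q x a b K k j

/-- The term with index `k` of the outer series on the right-hand side. -/
def rhsTerm {n : ℕ} (q : ℂ) (x : Fin n → ℂ) (a b : ℂ) (K : (Fin n → ℂ) → ℂ)
    (β : (Fin n → ℕ) → ℂ) (y : Fin n → ℂ) (k : Fin n → ℕ) : ℂ :=
  vandermonde q x k
    * (yFactor q x y k / ∏ r : Fin n, ∏ s : Fin n, qPoch q (q * (x r / x s)) (k r))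
    * ((1 - a * q ^ (2 * wt k)) * qPoch q a (wt k) /
        ((1 - a) * qPoch q (a * q * ∏ r, y r) (wt k)))
    * qShift q k
    * middleSum q x a b K β k

/-- Where all `y_s ≠ 0`, `lhsTerm` is the term of the series in its usual form. -/
theorem lhsTerm_eq {n : ℕ} (q : ℂ) (x : Fin n → ℂ) (b : ℂ) (β : (Fin n → ℕ) → ℂ)
    (y : Fin n → ℂ) (j : Fin n → ℕ) (hy : ∀ s, y s ≠ 0) :
    lhsTerm q x b β y j =
      vandermonde q x j * (∏ r : Fin n, ∏ s : Fin n, qPoch q (x r / (x s * y s)) (j r))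
        * ((1 - b * q ^ (2 * wt j)) / ((1 - b) * qPoch q (b * q * ∏ r, y r) (wt j)))
        * (∏ r, y r) ^ wt j * qShift q j * β j := by
  rw [lhsTerm, yFactor_eq q x y j hy]
  ring

/-- Where all `y_s ≠ 0`, `rhsTerm` is the term of the series in its usual form. -/
theorem rhsTerm_eq {n : ℕ} (q : ℂ) (x : Fin n → ℂ) (a b : ℂ) (K : (Fin n → ℂ) → ℂ)
    (β : (Fin n → ℕ) → ℂ) (y : Fin n → ℂ) (k : Fin n → ℕ) (hy : ∀ s, y s ≠ 0) :
    rhsTerm q x a b K β y k =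
      vandermonde q x k
        * (∏ r : Fin n, ∏ s : Fin n,
            qPoch q (x r / (x s * y s)) (k r) / qPoch q (q * (x r / x s)) (k r))
        * ((1 - a * q ^ (2 * wt k)) * qPoch q a (wt k) /
            ((1 - a) * qPoch q (a * q * ∏ r, y r) (wt k)))
        * (∏ r, y r) ^ wt k * qShift q k * middleSum q x a b K β k := by
  rw [rhsTerm, yFactor_eq q x y k hy]
  simp only [Finset.prod_div_distrib]
  ring

/-- The open polydisc around the origin in `ℂ^n` with radii `R_1, …, R_n`. -/
def polydisc {n : ℕ} (R : Fin n → ℝ) : Set (Fin n → ℂ) := {y | ∀ r, ‖y r‖ < R r}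

end

end AnSeries

/-! At `y = q^N` both series are finite and the identity is a matrix inversion. The summand on the
right can be regrouped (`rhsTerm_qPoint`) so that the outer index `k` interacts with `j` and `m`
only through `p = j + m`. After exchanging sums, each pair `j, m` carries a sum over `p ≤ k ≤ N`,
which vanishes unless `p = N` (`sum_inversion`). Only `m = N - j` survives; this pulls out `K(q^N)`,
and the diagonal entry reproduces the left-hand summand (`invFactor_self`, `invWeight_self`,
`qPoch_quotient`).

With `k = p + l`, `x` replaced by `x q^p` and `a` by `a q^(2|p|)`, the inversion relation becomes
the evaluation of a terminating very-well-poised `A_n` series as a Kronecker delta. Collecting terms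
with `|l| = L`, Milne's fundamental theorem (`sum_fundTerm`) sums out the `x`-dependence and leaves
a one-variable series whose partial sums are explicit products (`sum_range_wellPoised`). The
fundamental theorem follows by induction on `L` from a partial fraction identity.

In the analytic case the difference of the two sides vanishes at every `q^N` in the polydisc. These
points accumulate at the origin, so the one-variable identity theorem, applied to one coordinate
after another, makes the difference zero. Analyticity is needed for the sides as a whole, not for
`K`. -/

namespace AnSeries

/-! ### Calculus of `q`-shifted factorials -/

section Pochhammer

variable (q z : ℂ)

theorem qPoch_zero : qPoch q z 0 = 1 := by simp [qPoch]

theorem qPoch_succ (k : ℕ) : qPoch q z (k + 1) = qPoch q z k * (1 - z * q ^ k) := by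
  simp [qPoch, prod_range_succ]

theorem qPoch_add (k l : ℕ) : qPoch q z (k + l) = qPoch q z k * qPoch q (z * q ^ k) l := by
  simp only [qPoch, prod_range_add]
  congr 1
  refine prod_congr rfl fun i _ => ?_
  ring

theorem qPoch_succ' (k : ℕ) : qPoch q z (k + 1) = (1 - z) * qPoch q (z * q) k := by
  rw [add_comm, qPoch_add]
  simp [qPoch]

variable {q z}

theorem qPoch_ne_zero (h : ∀ i : ℕ, z * q ^ i ≠ 1) (k : ℕ) : qPoch q z k ≠ 0 :=
  prod_ne_zero_iff.2 fun i _ => sub_ne_zero.2 (h i).symm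

theorem qPoch_eq_zero {i k : ℕ} (h : z * q ^ i = 1) (hk : i < k) : qPoch q z k = 0 :=
  prod_eq_zero (mem_range.2 hk) (by rw [h, sub_self])

/-- Reversal of the order of the factors. -/
theorem qPoch_reverse (hq : q ≠ 0) {w : ℂ} (hw : w ≠ 0) (k : ℕ) :
    q ^ (k + 1).choose 2 * qPoch q (q ^ (-(k : ℤ)) * w) k =
      (-1) ^ k * w ^ k * qPoch q (q / w) k := by
  have h : qPoch q (q ^ (-(k : ℤ)) * w) k =
      ∏ i ∈ range k, (-1 * w * (q ^ (i + 1))⁻¹ * (1 - q / w * q ^ i)) := by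
    rw [qPoch, ← prod_range_reflect]
    refine prod_congr rfl fun i hi => ?_
    obtain ⟨d, rfl⟩ := Nat.exists_eq_add_of_lt (mem_range.1 hi)
    have e : i + d + 1 - 1 - i = d := by omega
    rw [e, zpow_neg, zpow_natCast]
    field_simp
    ring
  have hs : ∑ i ∈ range k, (i + 1) = (k + 1).choose 2 := by
    clear h
    induction k with
    | zero => rfl
    | succ k ih => rw [sum_range_succ, ih, Nat.choose_succ_succ' (k + 1) 1, Nat.choose_one_right,
        add_comm]
  rw [h, prod_mul_distrib, prod_mul_distrib, prod_const, card_range, prod_inv_distrib,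
    prod_pow_eq_pow_sum, mul_pow, qPoch, hs]
  field_simp

/-- Exchange of a shift of `t` by `q⁻ˡ` for one of `q / t` by `q⁻ᵖ`. -/
theorem qPoch_exchange (hq : q ≠ 0) {t : ℂ} (ht : t ≠ 0) (l p : ℕ) :
    qPoch q (q ^ (-(l : ℤ)) * t) p * q ^ (l * p) * qPoch q (q ^ (1 - (p : ℤ)) / t) l =
      qPoch q t p * qPoch q (q / t) l := by
  -- The product of length `l + p` starting at `q^(-l) t` is split after `l` factors and after `p`
  -- factors; the block of length `l` is reversed in each splitting.
  have h₁ := qPoch_reverse hq ht l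
  have h₂ := qPoch_reverse hq (mul_ne_zero (pow_ne_zero p hq) ht) l
  have h₃ := qPoch_add q (q ^ (-(l : ℤ)) * t) l p
  rw [add_comm l p, qPoch_add] at h₃
  have e₁ : q ^ (-(l : ℤ)) * t * q ^ l = t := by
    rw [zpow_neg, zpow_natCast]; field_simp
  have e₂ : q ^ (-(l : ℤ)) * t * q ^ p = q ^ (-(l : ℤ)) * (q ^ p * t) := by ring
  have e₃ : q / (q ^ p * t) = q ^ (1 - (p : ℤ)) / t := by
    rw [zpow_sub₀ hq, zpow_one, zpow_natCast]; field_simp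
  rw [e₁, e₂] at h₃
  rw [e₃, mul_pow, ← pow_mul] at h₂
  have h0 : (-1 : ℂ) ^ l * t ^ l ≠ 0 := mul_ne_zero (pow_ne_zero _ (by norm_num)) (pow_ne_zero _ ht)
  refine mul_left_cancel₀ h0 ?_
  rw [mul_comm p l] at h₂
  linear_combination (-qPoch q (q ^ (-(l : ℤ)) * t) p) * h₂ + q ^ (l + 1).choose 2 * h₃ +
    qPoch q t p * h₁

end Pochhammer

/-! ### A partial fraction identity -/

section PartialFractions

open Polynomial in
/-- Partial fractions: the value at `0` of the polynomial
`∏ s, (1 - c s * X) - (∏ s, c s * u s) * ∏ s, (1 - X / u s)`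
by interpolation at the points `u i`. -/
theorem sum_prod_div_eq {n : ℕ} (u c : Fin n → ℂ) (hu : ∀ i, u i ≠ 0)
    (hinj : Function.Injective u) :
    ∑ i, (∏ s, (1 - c s * u i)) / ∏ s ∈ univ.erase i, (1 - u i / u s) = 1 - ∏ s, c s * u s := by
  set P : ℂ[X] := ∏ s, (1 - C (c s) * X) with hP
  set Q : ℂ[X] := ∏ s, (1 - C (u s)⁻¹ * X) with hQ
  set R : ℂ[X] := P - C (∏ s, c s * u s) * Q with hR
  have hdeg : ∀ a : ℂ, (1 - C a * X).natDegree ≤ 1 := fun a => by compute_degree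
  have hnat : ∀ f : Fin n → ℂ, (∏ s, (1 - C (f s) * X)).natDegree ≤ n := fun f =>
    (natDegree_prod_le _ _).trans ((sum_le_sum fun s _ => hdeg (f s)).trans (by simp))
  have hco : ∀ f : Fin n → ℂ, (∏ s, (1 - C (f s) * X)).coeff n = ∏ s, (-f s) := fun f => by
    have := coeff_prod_of_natDegree_le (s := univ) (fun s => 1 - C (f s) * X) 1
      fun s _ => hdeg (f s)
    rw [card_univ, Fintype.card_fin, mul_one] at this
    rw [this]
    simp [coeff_one]
  -- The constant `∏ c_s u_s` makes the coefficients of `X^n` cancel, so the `n` nodes determine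
  -- `R`.
  have hRdeg : R.degree < #(univ : Finset (Fin n)) := by
    rw [card_univ, Fintype.card_fin, degree_lt_iff_coeff_zero]
    intro m hm
    rw [hR, coeff_sub, coeff_C_mul]
    rcases hm.eq_or_lt with rfl | hm
    · rw [hP, hQ, hco, hco, ← prod_mul_distrib, sub_eq_zero]
      refine prod_congr rfl fun s _ => ?_
      have := hu s
      field_simp
    · rw [coeff_eq_zero_of_natDegree_lt ((hnat _).trans_lt hm),
        coeff_eq_zero_of_natDegree_lt ((hnat _).trans_lt hm), mul_zero, sub_zero]
  have h := congrArg (eval 0) (Lagrange.eq_interpolate (s := univ) (v := u) hinj.injOn hRdeg)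
  have hR0 : eval 0 R = 1 - ∏ s, c s * u s := by
    simp [hR, hP, hQ, eval_prod]
  have hRi : ∀ i, eval (u i) R = ∏ s, (1 - c s * u i) := fun i => by
    have : eval (u i) Q = 0 := by
      rw [hQ, eval_prod]
      exact prod_eq_zero (mem_univ i) (by simp [hu i])
    rw [hR, eval_sub, eval_mul, this, mul_zero, sub_zero, hP, eval_prod]
    simp
  rw [← hR0, h, Lagrange.interpolate_apply, eval_finsetSum]
  refine sum_congr rfl fun i _ => ?_
  rw [eval_mul, eval_C, hRi, Lagrange.basis, eval_prod, div_eq_mul_inv, ← prod_inv_distrib]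
  congr 1
  refine prod_congr rfl fun s hs => ?_
  have h₁ : u i - u s ≠ 0 := sub_ne_zero.2 (hinj.ne (ne_of_mem_erase hs).symm)
  have h₂ : u s - u i ≠ 0 := sub_ne_zero.2 (hinj.ne (ne_of_mem_erase hs))
  have := hu s
  simp only [Lagrange.basisDivisor, eval_mul, eval_C, eval_sub, eval_X]
  field_simp
  ring

end PartialFractions

/-! ### Generic variables and their shifts by powers of `q` -/

section Generic

variable {n : ℕ}

/-- The nondegeneracy of the base `q` and the variables `x` under which no denominator
depending on them alone vanishes. -/
structure IsGeneric (q : ℂ) (x : Fin n → ℂ) : Prop where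
  q_ne : q ≠ 0
  q_pow : ∀ i : ℕ, q ^ (i + 1) ≠ 1
  x_ne : ∀ r, x r ≠ 0
  ratio : ∀ r s, r ≠ s → ∀ i : ℤ, q ^ i * (x r / x s) ≠ 1

/-- `x q^p`. -/
noncomputable def qScale (q : ℂ) (x : Fin n → ℂ) (p : Fin n → ℕ) : Fin n → ℂ :=
  fun r => x r * q ^ p r

namespace IsGeneric

variable {q : ℂ} {x : Fin n → ℂ}

theorem scale (h : IsGeneric q x) (p : Fin n → ℕ) : IsGeneric q (qScale q x p) where
  q_ne := h.q_ne
  q_pow := h.q_pow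
  x_ne r := mul_ne_zero (h.x_ne r) (pow_ne_zero _ h.q_ne)
  ratio r s hrs i := by
    have := h.ratio r s hrs (i + p r - p s)
    rw [zpow_sub₀ h.q_ne, zpow_add₀ h.q_ne, zpow_natCast, zpow_natCast] at this
    convert this using 1
    have := h.q_ne
    have := h.x_ne s
    simp only [qScale]
    field_simp

theorem injective (h : IsGeneric q x) : Function.Injective x := fun r s hrs => by
  by_contra hne
  refine h.ratio r s hne 0 ?_
  rw [hrs, div_self (h.x_ne s), zpow_zero, one_mul]

theorem ratio_pow (h : IsGeneric q x) (r s : Fin n) (i : ℕ) : q * (x r / x s) * q ^ i ≠ 1 := by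
  by_cases hrs : r = s
  · subst hrs
    rw [div_self (h.x_ne r), mul_one, ← pow_succ']
    exact h.q_pow i
  · have := h.ratio r s hrs (i + 1 : ℕ)
    rw [zpow_natCast] at this
    convert this using 1
    ring

theorem qPoch_ne_zero (h : IsGeneric q x) (r s : Fin n) (k : ℕ) :
    qPoch q (q * (x r / x s)) k ≠ 0 :=
  AnSeries.qPoch_ne_zero (h.ratio_pow r s) k

theorem one_sub_zpow_ne (h : IsGeneric q x) {r s : Fin n} (hrs : r ≠ s) (i : ℤ) :
    1 - q ^ i * (x r / x s) ≠ 0 := sub_ne_zero.2 (h.ratio r s hrs i).symm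

theorem one_sub_ne (h : IsGeneric q x) {r s : Fin n} (hrs : r ≠ s) : 1 - x r / x s ≠ 0 := by
  simpa using h.one_sub_zpow_ne hrs 0

end IsGeneric

theorem wt_add (k l : Fin n → ℕ) : wt (k + l) = wt k + wt l := by
  simp [wt, sum_add_distrib]

theorem qScale_ratio {q : ℂ} {x : Fin n → ℂ} (h : q ≠ 0) (p : Fin n → ℕ) (r s : Fin n) :
    qScale q x p r / qScale q x p s = q ^ ((p r : ℤ) - (p s : ℤ)) * (x r / x s) := by
  rw [zpow_sub₀ h, zpow_natCast, zpow_natCast]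
  simp only [qScale]
  field_simp

end Generic

/-! ### Quotients of Vandermonde products -/

section Vandermonde

variable {n : ℕ} {q : ℂ} {x : Fin n → ℂ}

/-- The quotient `∏_{r < s} (x_r q^{k_r} - x_s q^{k_s}) / (x_r - x_s)` of Vandermonde products. -/
noncomputable def vdm (q : ℂ) (x : Fin n → ℂ) (k : Fin n → ℕ) : ℂ :=
  vandermonde q x k * qShift q k

theorem qShift_add (p l : Fin n → ℕ) : qShift q (p + l) = qShift q p * qShift q l := by
  simp [qShift, ← pow_add, mul_add, sum_add_distrib]

theorem vandermonde_ratio (h : IsGeneric q x) (p k : Fin n → ℕ) :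
    vandermonde q x p * ∏ r : Fin n, ∏ s ∈ Ioi r,
      (1 - q ^ ((k r : ℤ) - (k s : ℤ)) * (x r / x s)) /
        (1 - q ^ ((p r : ℤ) - (p s : ℤ)) * (x r / x s)) = vandermonde q x k := by
  simp only [vandermonde, ← prod_mul_distrib]
  refine prod_congr rfl fun r _ => prod_congr rfl fun s hs => ?_
  have hrs : r ≠ s := (mem_Ioi.1 hs).ne
  rw [mul_comm, div_mul_div_cancel₀ (h.one_sub_zpow_ne hrs _)]

/-- The quotients telescope through the intermediate point `x q^p`. This lets every later shift of
indices be absorbed into a change of base point. -/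
theorem vdm_add (h : IsGeneric q x) (p l : Fin n → ℕ) :
    vdm q x (p + l) = vdm q x p * vdm q (qScale q x p) l := by
  rw [vdm, vdm, vdm, qShift_add, ← vandermonde_ratio h p (p + l)]
  suffices (∏ r : Fin n, ∏ s ∈ Ioi r,
      (1 - q ^ (((p + l) r : ℕ) - ((p + l) s : ℕ) : ℤ) * (x r / x s)) /
        (1 - q ^ ((p r : ℤ) - (p s : ℤ)) * (x r / x s))) = vandermonde q (qScale q x p) l by
    rw [this]; ring
  refine prod_congr rfl fun r _ => prod_congr rfl fun s _ => ?_
  rw [qScale_ratio h.q_ne, ← mul_assoc, ← zpow_add₀ h.q_ne]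
  congr 4
  simp only [Pi.add_apply]
  push_cast
  ring

theorem vdm_single (h : IsGeneric q x) (i : Fin n) :
    vdm q x (Pi.single i 1) = ∏ s ∈ univ.erase i, ((x s - q * x i) / (x s - x i)) := by
  set g : Fin n → ℂ := fun s => (x s - q * x i) / (x s - x i) with hg
  have hq := h.q_ne
  -- Only pairs containing `i` contribute. Each `r < i` leaves a factor `q⁻¹`; there are `i` of them
  -- (indices start at `0`), and `qShift` cancels them.
  have key : vandermonde q x (Pi.single i 1) = (∏ s ∈ Ioi i, g s) * ∏ r ∈ Iio i, (q⁻¹ * g r) := by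
    have h₁ : ∀ r : Fin n, ∀ s ∈ Ioi r,
        (1 - q ^ (((Pi.single i 1 : Fin n → ℕ) r : ℤ) - ((Pi.single i 1 : Fin n → ℕ) s : ℤ))
          * (x r / x s)) / (1 - x r / x s) =
        (if r = i then g s else 1) * (if s = i then q⁻¹ * g r else 1) := by
      intro r s hs
      have hrs : r < s := mem_Ioi.1 hs
      have hd := h.one_sub_ne hrs.ne
      have hxs := h.x_ne s
      have hsub : x s - x r ≠ 0 := sub_ne_zero.2 (h.injective.ne hrs.ne')
      have hsub' : x r - x s ≠ 0 := sub_ne_zero.2 (h.injective.ne hrs.ne)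
      have e : 1 - x r / x s = (x s - x r) / x s := by field_simp
      by_cases hr : r = i
      · subst hr
        rw [if_pos rfl, if_neg hrs.ne', Pi.single_eq_same, Pi.single_eq_of_ne hrs.ne', e]
        simp only [hg, Nat.cast_one, Nat.cast_zero, sub_zero, zpow_one]
        field_simp
      · rw [if_neg hr, Pi.single_eq_of_ne hr]
        by_cases hs : s = i
        · subst hs
          rw [if_pos rfl, Pi.single_eq_same, e]
          simp only [hg, Nat.cast_one, Nat.cast_zero, zero_sub, zpow_neg, zpow_one]
          field_simp
          ring
        · rw [if_neg hs, Pi.single_eq_of_ne hs]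
          simp [div_self hd]
    rw [vandermonde, prod_congr rfl fun r _ => prod_congr rfl (h₁ r)]
    simp only [prod_mul_distrib]
    congr 1
    · rw [prod_eq_single i]
      · simp
      · intro r _ hr
        simp [hr]
      · simp
    · rw [← prod_mul_distrib]
      simp only [prod_ite_eq', mem_Ioi]
      rw [← prod_filter]
      refine prod_congr (by ext; simp) fun _ _ => rfl
  have hsh : qShift q (Pi.single i 1 : Fin n → ℕ) = q ^ (i : ℕ) := by
    rw [qShift]
    congr 1
    rw [sum_eq_single i]
    · simp
    · intro r _ hr
      simp [Pi.single_eq_of_ne hr]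
    · simp
  have hun : univ.erase i = Ioi i ∪ Iio i := by
    ext s
    simp only [mem_erase, mem_univ, and_true, mem_union, mem_Ioi, mem_Iio]
    constructor
    · intro hs; exact (lt_or_gt_of_ne hs).symm
    · rintro (hs | hs)
      · exact hs.ne'
      · exact hs.ne
  have hdisj : Disjoint (Ioi i) (Iio i) := by
    rw [disjoint_left]
    intro s hs hs'
    exact (mem_Ioi.1 hs).asymm (mem_Iio.1 hs')
  rw [vdm, key, hsh, prod_mul_distrib, prod_const, Fin.card_Iio, hun, prod_union hdisj, inv_pow]
  have := pow_ne_zero (i : ℕ) hq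
  generalize (∏ s ∈ Ioi i, g s) = A, (∏ s ∈ Iio i, g s) = B
  field_simp

end Vandermonde

/-! ### The `A_n` `q`-binomial theorem -/

section FundamentalTheorem

variable {n : ℕ} {q : ℂ} {z : Fin n → ℂ}

/-- The summand of the `A_n` `q`-binomial theorem. -/
noncomputable def fundTerm (q : ℂ) (z a : Fin n → ℂ) (l : Fin n → ℕ) : ℂ :=
  vdm q z l * ∏ r, ∏ s, (qPoch q (a s * (z r / z s)) (l r) / qPoch q (q * (z r / z s)) (l r))

theorem fundTerm_add_single (h : IsGeneric q z) (a : Fin n → ℂ) (l : Fin n → ℕ) (i : Fin n) :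
    fundTerm q z a (l + Pi.single i 1) = fundTerm q z a l *
      ((∏ s ∈ univ.erase i,
        ((qScale q z l s - q * qScale q z l i) / (qScale q z l s - qScale q z l i))) *
      ∏ s, ((1 - a s * (z i / z s) * q ^ l i) / (1 - q * (z i / z s) * q ^ l i))) := by
  rw [fundTerm, fundTerm, vdm_add h, vdm_single (h.scale l)]
  have : ∀ r, (∏ s, (qPoch q (a s * (z r / z s)) ((l + Pi.single i 1 : Fin n → ℕ) r) /
      qPoch q (q * (z r / z s)) ((l + Pi.single i 1 : Fin n → ℕ) r))) =
      (∏ s, (qPoch q (a s * (z r / z s)) (l r) / qPoch q (q * (z r / z s)) (l r))) *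
      if r = i then
        ∏ s, ((1 - a s * (z i / z s) * q ^ l i) / (1 - q * (z i / z s) * q ^ l i)) else 1 := by
    intro r
    by_cases hr : r = i
    · subst hr
      rw [if_pos rfl, ← prod_mul_distrib]
      refine prod_congr rfl fun s _ => ?_
      rw [Pi.add_apply, Pi.single_eq_same, qPoch_succ, qPoch_succ, mul_div_mul_comm]
    · rw [if_neg hr, Pi.add_apply, Pi.single_eq_of_ne hr, add_zero, mul_one]
  rw [prod_congr rfl fun r _ => this r, prod_mul_distrib, prod_ite_eq' univ i]
  simp only [mem_univ, if_true]
  ring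

/-- Links levels `L` and `L + 1` of the induction: a partial fraction summand at `l` with `c_s = a_s
/ z_s` is the one at `l + e_i` with `c_s = 1 / z_s`. -/
theorem fundTerm_mul_eq (h : IsGeneric q z) (a : Fin n → ℂ) (l : Fin n → ℕ) (i : Fin n) :
    fundTerm q z a l * ((∏ s, (1 - a s / z s * qScale q z l i)) /
      ∏ s ∈ univ.erase i, (1 - qScale q z l i / qScale q z l s)) =
    fundTerm q z a (l + Pi.single i 1) *
      ((∏ s, (1 - 1 / z s * qScale q z (l + Pi.single i 1) i)) /
      ∏ s ∈ univ.erase i,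
        (1 - qScale q z (l + Pi.single i 1) i / qScale q z (l + Pi.single i 1) s)) := by
  rw [fundTerm_add_single h, mul_assoc (fundTerm q z a l)]
  congr 1
  have hl := h.scale l
  have e₁ : ∏ s, (1 - 1 / z s * qScale q z (l + Pi.single i 1) i) =
      ∏ s, (1 - q * (z i / z s) * q ^ l i) := by
    refine prod_congr rfl fun s _ => ?_
    simp only [qScale, Pi.add_apply, Pi.single_eq_same]
    ring
  have e₂ : ∏ s, (1 - a s / z s * qScale q z l i) = ∏ s, (1 - a s * (z i / z s) * q ^ l i) := by
    refine prod_congr rfl fun s _ => ?_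
    simp only [qScale]
    ring
  have e₃ : (∏ s ∈ univ.erase i,
        ((qScale q z l s - q * qScale q z l i) / (qScale q z l s - qScale q z l i))) /
      (∏ s ∈ univ.erase i,
        (1 - qScale q z (l + Pi.single i 1) i / qScale q z (l + Pi.single i 1) s)) =
      1 / ∏ s ∈ univ.erase i, (1 - qScale q z l i / qScale q z l s) := by
    rw [← prod_div_distrib, one_div, ← prod_inv_distrib]
    refine prod_congr rfl fun s hs => ?_
    have hsi := ne_of_mem_erase hs
    have f₁ : qScale q z (l + Pi.single i 1) i = q * qScale q z l i := by
      simp only [qScale, Pi.add_apply, Pi.single_eq_same]; ring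
    have f₂ : qScale q z (l + Pi.single i 1) s = qScale q z l s := by
      simp [qScale, Pi.single_eq_of_ne hsi]
    have hx := hl.x_ne s
    have g₁ : 1 - qScale q z l i / qScale q z l s =
        (qScale q z l s - qScale q z l i) / qScale q z l s := by field_simp
    have g₂ : 1 - q * qScale q z l i / qScale q z l s =
        (qScale q z l s - q * qScale q z l i) / qScale q z l s := by field_simp
    have g₃ : qScale q z l s - q * qScale q z l i ≠ 0 := by
      have := hl.one_sub_zpow_ne hsi.symm 1
      rw [zpow_one, ← mul_div_assoc, g₂] at this
      exact (div_ne_zero_iff.1 this).1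
    have g₄ : qScale q z l s - qScale q z l i ≠ 0 := sub_ne_zero.2 (hl.injective.ne hsi)
    rw [f₁, f₂, g₁, g₂]
    field_simp
  have hne : ∏ s, (1 - q * (z i / z s) * q ^ l i) ≠ 0 :=
    prod_ne_zero_iff.2 fun s _ => sub_ne_zero.2 (h.ratio_pow i s _).symm
  rw [e₁, e₂, div_eq_mul_one_div, ← e₃,
    prod_div_distrib (f := fun s => 1 - a s * (z i / z s) * q ^ l i)]
  generalize ∏ s, (1 - q * (z i / z s) * q ^ l i) = A at hne ⊢
  generalize ∏ s, (1 - a s * (z i / z s) * q ^ l i) = B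
  rw [← mul_div_assoc, ← mul_div_assoc, ← mul_div_assoc]
  congr 1
  rw [div_mul_cancel₀ _ hne, mul_comm]

theorem sum_piAntidiag_add_single (L : ℕ) (f : (Fin n → ℕ) → Fin n → ℂ)
    (hf : ∀ k i, k i = 0 → f k i = 0) :
    ∑ l ∈ piAntidiag univ L, ∑ i, f (l + Pi.single i 1) i =
      ∑ k ∈ piAntidiag univ (L + 1), ∑ i, f k i := by
  rw [sum_comm, sum_comm (s := piAntidiag univ (L + 1))]
  refine sum_congr rfl fun i _ => ?_
  refine sum_of_injOn (fun l => l + Pi.single i 1) (add_left_injective _).injOn ?_ ?_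
    fun _ _ => rfl
  · intro l hl
    simp only [mem_coe, mem_piAntidiag, mem_univ, implies_true, and_true] at hl ⊢
    simp [sum_add_distrib, hl]
  · intro k hk hk'
    refine hf k i ?_
    by_contra h0
    have hk0 : k - Pi.single i 1 + Pi.single i 1 = k :=
      tsub_add_cancel_of_le fun r => by
        by_cases hr : r = i
        · subst hr
          rw [Pi.single_eq_same]
          exact Nat.one_le_iff_ne_zero.2 h0
        · simp [Pi.single_eq_of_ne hr]
    refine hk' ⟨k - Pi.single i 1, ?_, hk0⟩
    simp only [mem_coe, mem_piAntidiag, mem_univ, implies_true, and_true] at hk ⊢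
    have : ∑ r, (k - Pi.single i 1 + Pi.single i 1 : Fin n → ℕ) r = L + 1 := by rw [hk0, hk]
    simpa [sum_add_distrib] using this

/-- The `A_n` `q`-binomial theorem (Milne's fundamental theorem). -/
theorem sum_fundTerm (h : IsGeneric q z) (a : Fin n → ℂ) (L : ℕ) :
    ∑ l ∈ piAntidiag univ L, fundTerm q z a l = qPoch q (∏ s, a s) L / qPoch q q L := by
  have hprod : ∀ c : Fin n → ℂ, ∀ L : ℕ, ∀ l ∈ piAntidiag univ L,
      ∏ s, (c s / z s * qScale q z l s) = (∏ s, c s) * q ^ L := by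
    intro c L l hl
    simp only [mem_piAntidiag] at hl
    rw [← hl.1, ← prod_pow_eq_pow_sum, ← prod_mul_distrib]
    refine prod_congr rfl fun s _ => ?_
    have := h.x_ne s
    simp only [qScale]
    field_simp
  induction L with
  | zero =>
    simp only [piAntidiag_zero, sum_singleton, fundTerm, vdm, vandermonde, qShift, qPoch_zero,
      Pi.zero_apply, mul_zero, sum_const_zero, pow_zero, mul_one, div_one, prod_const_one,
      Nat.cast_zero, sub_zero, zpow_zero, one_mul]
    exact prod_eq_one fun r _ => prod_eq_one fun s hs => div_self (h.one_sub_ne (mem_Ioi.1 hs).ne)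
  | succ L ih =>
    -- The weighted sum over pairs `(l, i)` is evaluated by partial fractions at both levels, giving
    -- the recurrence in `L`.
    have step : (1 - (∏ s, a s) * q ^ L) * ∑ l ∈ piAntidiag univ L, fundTerm q z a l =
        (1 - q ^ (L + 1)) * ∑ k ∈ piAntidiag univ (L + 1), fundTerm q z a k := by
      rw [mul_sum, mul_sum]
      calc _ = ∑ l ∈ piAntidiag univ L, ∑ i, fundTerm q z a l *
              ((∏ s, (1 - a s / z s * qScale q z l i)) /
                ∏ s ∈ univ.erase i, (1 - qScale q z l i / qScale q z l s)) := by
            refine sum_congr rfl fun l hl => ?_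
            rw [← mul_sum, sum_prod_div_eq _ _ (h.scale l).x_ne (h.scale l).injective,
              hprod a L l hl, mul_comm]
        _ = ∑ k ∈ piAntidiag univ (L + 1), ∑ i, fundTerm q z a k *
              ((∏ s, (1 - 1 / z s * qScale q z k i)) /
                ∏ s ∈ univ.erase i, (1 - qScale q z k i / qScale q z k s)) := by
            rw [← sum_piAntidiag_add_single]
            · exact sum_congr rfl fun l _ => sum_congr rfl fun i _ => fundTerm_mul_eq h a l i
            -- If `k_i = 0`, the factor `s = i` is `1 - z_i / z_i`; these are exactly the `k` not of
            -- the form `l + e_i`.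
            · intro k i hk
              have := h.x_ne i
              rw [prod_eq_zero (mem_univ i), zero_div, mul_zero]
              simp [qScale, hk, this]
        _ = _ := by
            refine sum_congr rfl fun k hk => ?_
            rw [← mul_sum, sum_prod_div_eq _ _ (h.scale k).x_ne (h.scale k).injective,
              hprod (fun _ => 1) (L + 1) k hk, mul_comm, prod_const_one, one_mul]
    have h₁ : 1 - q ^ (L + 1) ≠ 0 := sub_ne_zero.2 (h.q_pow L).symm
    have h₂ : qPoch q q L ≠ 0 :=
      qPoch_ne_zero (fun i => by rw [← pow_succ']; exact h.q_pow i) L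
    rw [ih] at step
    rw [qPoch_succ, qPoch_succ, ← pow_succ']
    field_simp at step ⊢
    linear_combination -step

end FundamentalTheorem

/-! ### Terminating very-well-poised series -/

section Terminating

/-- Partial sums of a terminating very-well-poised series in one variable. -/
theorem sum_range_wellPoised {q v w A : ℂ} (hq : ∀ i : ℕ, q ^ (i + 1) ≠ 1) (hvw : v * w = 1)
    (hA : A ≠ 1) (hw : ∀ i : ℕ, A * q * w * q ^ i ≠ 1) (T : ℕ) :
    ∑ L ∈ range (T + 1), qPoch q v L / qPoch q q L *
        ((1 - A * q ^ (2 * L)) * qPoch q A L / ((1 - A) * qPoch q (A * q * w) L)) * w ^ L =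
      qPoch q (A * q) T * qPoch q (v * q) T / (qPoch q q T * qPoch q (A * q * w) T) * w ^ T := by
  have h1A : 1 - A ≠ 0 := sub_ne_zero.2 hA.symm
  induction T with
  | zero => simp [qPoch_zero, h1A]
  | succ T ih =>
    rw [sum_range_succ, ih, qPoch_succ' q v, qPoch_succ' q A, qPoch_succ q (A * q) T,
      qPoch_succ q (v * q), qPoch_succ q q, qPoch_succ q (A * q * w)]
    have h₁ : qPoch q q T ≠ 0 := qPoch_ne_zero (fun i => by rw [← pow_succ']; exact hq i) T
    have h₂ : qPoch q (A * q * w) T ≠ 0 := qPoch_ne_zero hw T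
    have h₃ : 1 - q * q ^ T ≠ 0 := by rw [← pow_succ']; exact sub_ne_zero.2 (hq T).symm
    have h₄ : 1 - A * q * w * q ^ T ≠ 0 := sub_ne_zero.2 (hw T).symm
    field_simp
    linear_combination qPoch q (A * q) T * qPoch q (q * v) T * w ^ T * (q * q ^ T - 1) * hvw

theorem sum_wellPoised {q A : ℂ} (hq0 : q ≠ 0) (hq : ∀ i : ℕ, q ^ (i + 1) ≠ 1)
    (hA : ∀ i : ℕ, A * q ^ i ≠ 1) (W : ℕ) :
    ∑ L ∈ range (W + 1), qPoch q (q ^ (-(W : ℤ))) L / qPoch q q L *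
        ((1 - A * q ^ (2 * L)) * qPoch q A L / ((1 - A) * qPoch q (A * q ^ (1 + W)) L)) *
          q ^ (W * L) = if W = 0 then 1 else 0 := by
  have h := sum_range_wellPoised (q := q) (v := q ^ (-(W : ℤ))) (w := q ^ W) (A := A) hq
    (by rw [zpow_neg, zpow_natCast, inv_mul_cancel₀ (pow_ne_zero _ hq0)])
    (by simpa using hA 0) (fun i => by
      have := hA (1 + W + i)
      rwa [pow_add, pow_add, pow_one, ← mul_assoc, ← mul_assoc] at this) W
  simp only [pow_add, pow_one, pow_mul] at h ⊢
  simp only [mul_assoc] at h ⊢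
  rw [h]
  split_ifs with hW
  · simp [hW, qPoch_zero]
  -- The closed form contains `(q^(1-W))_W`, whose last factor is zero.
  · obtain ⟨d, rfl⟩ := Nat.exists_eq_succ_of_ne_zero hW
    rw [qPoch_eq_zero (z := q ^ (-((d.succ : ℕ) : ℤ)) * q) (i := d) _ (Nat.lt_succ_self d)]
    · ring
    · rw [zpow_neg, zpow_natCast, mul_assoc, ← pow_succ',
        inv_mul_cancel₀ (pow_ne_zero _ hq0)]

variable {n : ℕ} {q : ℂ} {z : Fin n → ℂ}

theorem fundTerm_eq_zero (h : IsGeneric q z) {M l : Fin n → ℕ} (hl : ¬ l ≤ M) :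
    fundTerm q z (fun s => q ^ (-(M s : ℤ))) l = 0 := by
  obtain ⟨r, hr⟩ := not_forall.1 hl
  rw [fundTerm, prod_eq_zero (mem_univ r), mul_zero]
  rw [prod_eq_zero (mem_univ r)]
  rw [qPoch_eq_zero (i := M r) _ (not_le.1 hr), zero_div]
  rw [div_self (h.x_ne r), mul_one, zpow_neg, zpow_natCast,
    inv_mul_cancel₀ (pow_ne_zero _ h.q_ne)]

theorem wt_mono {l M : Fin n → ℕ} (h : l ≤ M) : wt l ≤ wt M := sum_le_sum fun r _ => h r

theorem wt_eq_zero {M : Fin n → ℕ} : wt M = 0 ↔ M = 0 := by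
  simp [wt, funext_iff]

/-- The terminating very-well-poised `A_n` series is `δ_{M,0}`. -/
theorem sum_fundTerm_wellPoised (h : IsGeneric q z) {A : ℂ} (hA : ∀ i : ℕ, A * q ^ i ≠ 1)
    (M : Fin n → ℕ) :
    ∑ l ∈ Icc 0 M, fundTerm q z (fun s => q ^ (-(M s : ℤ))) l *
        ((1 - A * q ^ (2 * wt l)) * qPoch q A (wt l) /
          ((1 - A) * qPoch q (A * q ^ (1 + wt M)) (wt l))) * q ^ (wt M * wt l) =
      if M = 0 then 1 else 0 := by
  have hprod : ∏ s, q ^ (-(M s : ℤ)) = q ^ (-(wt M : ℤ)) := by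
    simp only [wt, zpow_neg, prod_inv_distrib, zpow_natCast, prod_pow_eq_pow_sum]
  -- Besides `fundTerm`, the summand sees `l` only through `|l|`. On each level the box may be
  -- enlarged to all `l`, since `fundTerm` vanishes outside it.
  rw [← sum_fiberwise_of_maps_to (t := range (wt M + 1)) (g := wt)
    fun l hl => mem_range.2 (Nat.lt_succ_of_le (wt_mono (mem_Icc.1 hl).2))]
  simp only [← wt_eq_zero (M := M)]
  rw [← sum_wellPoised h.q_ne h.q_pow hA (wt M)]
  refine sum_congr rfl fun L _ => ?_
  rw [← hprod, ← sum_fundTerm h, sum_mul, sum_mul]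
  refine sum_subset_zero_on_sdiff ?_ ?_ ?_
  · intro l hl
    simpa [wt] using (mem_filter.1 hl).2
  · intro l hl
    have hlL : wt l = L := by simpa [wt] using (mem_sdiff.1 hl).1
    rw [fundTerm_eq_zero h, zero_mul, zero_mul]
    intro hlM
    exact (mem_sdiff.1 hl).2 (mem_filter.2 ⟨mem_Icc.2 ⟨fun _ => Nat.zero_le _, hlM⟩, hlL⟩)
  · intro l hl
    rw [(mem_filter.1 hl).2]

end Terminating

/-! ### The inversion relation -/

section Inversion

variable {n : ℕ} {q : ℂ} {x : Fin n → ℂ}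

theorem prod_qPoint (q : ℂ) (N : Fin n → ℕ) : ∏ r, qPoint q N r = q ^ wt N := by
  simp only [qPoint, wt, prod_pow_eq_pow_sum]

theorem yFactor_qPoint_eq_zero (h : IsGeneric q x) {N k : Fin n → ℕ} (hk : ¬ k ≤ N) :
    yFactor q x (qPoint q N) k = 0 := by
  obtain ⟨r, hr⟩ := not_forall.1 hk
  refine prod_eq_zero (mem_univ r) (prod_eq_zero (mem_univ r)
    (prod_eq_zero (mem_range.2 (not_le.1 hr)) ?_))
  rw [div_self (h.x_ne r), mul_one, qPoint, sub_self]

theorem yFactor_qPoint_add (h : IsGeneric q x) (p M l : Fin n → ℕ) :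
    yFactor q x (qPoint q (p + M)) (p + l) = yFactor q x (qPoint q (p + M)) p *
      (q ^ (wt (p + M) * wt l) * ∏ r, ∏ s,
        qPoch q (q ^ (-(M s : ℤ)) * (qScale q x p r / qScale q x p s)) (l r)) := by
  have hq := h.q_ne
  have e : q ^ (wt (p + M) * wt l) = ∏ r, ∏ s : Fin n, (q ^ (p + M : Fin n → ℕ) s) ^ l r := by
    rw [pow_mul, wt, wt, ← prod_pow_eq_pow_sum (f := l)]
    refine prod_congr rfl fun r _ => ?_
    rw [← prod_pow_eq_pow_sum, prod_pow]
  rw [e, yFactor, yFactor, ← prod_mul_distrib, ← prod_mul_distrib]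
  refine prod_congr rfl fun r _ => ?_
  rw [← prod_mul_distrib, ← prod_mul_distrib]
  refine prod_congr rfl fun s _ => ?_
  rw [Pi.add_apply p l, prod_range_add]
  congr 1
  rw [qPoch, ← card_range (l r), ← prod_const, card_range, ← prod_mul_distrib]
  refine prod_congr rfl fun i _ => ?_
  have hs := h.x_ne s
  rw [zpow_neg, zpow_natCast]
  simp only [qPoint, qScale, Pi.add_apply]
  field_simp
  ring

theorem prod_qPoch_exchange (h : IsGeneric q x) (p l : Fin n → ℕ) :
    (∏ r, ∏ s, qPoch q (q ^ (-((p + l : Fin n → ℕ) s : ℤ)) * (x r / x s)) (p r)) *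
        q ^ (wt l * wt p) *
        (∏ r, ∏ s, qPoch q (q * (qScale q x p r / qScale q x p s)) (l r)) =
      (∏ r, ∏ s, qPoch q (q ^ (-(p s : ℤ)) * (x r / x s)) (p r)) *
        ∏ r, ∏ s, qPoch q (q * (x r / x s) * q ^ p r) (l r) := by
  have hq := h.q_ne
  have e : q ^ (wt l * wt p) = ∏ r, ∏ s : Fin n, q ^ (l s * p r) := by
    rw [wt, wt, mul_comm, sum_mul_sum, ← prod_pow_eq_pow_sum]
    refine prod_congr rfl fun r _ => ?_
    rw [← prod_pow_eq_pow_sum]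
    exact prod_congr rfl fun s _ => by rw [mul_comm]
  -- `qPoch_exchange` inverts the ratio `x_r / x_s`, so two of the double products are transposed
  -- before comparing factors.
  rw [e, prod_comm (f := fun r s => qPoch q (q * (qScale q x p r / qScale q x p s)) (l r)),
    prod_comm (f := fun r s => qPoch q (q * (x r / x s) * q ^ p r) (l r))]
  simp only [← prod_mul_distrib]
  refine prod_congr rfl fun r _ => prod_congr rfl fun s _ => ?_
  have hr := h.x_ne r
  have hs := h.x_ne s
  have key := qPoch_exchange hq (t := q ^ (-(p s : ℤ)) * (x r / x s))
    (mul_ne_zero (zpow_ne_zero _ hq) (div_ne_zero hr hs)) (l s) (p r)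
  have e₁ : q ^ (-(l s : ℤ)) * (q ^ (-(p s : ℤ)) * (x r / x s)) =
      q ^ (-((p + l : Fin n → ℕ) s : ℤ)) * (x r / x s) := by
    rw [← mul_assoc, ← zpow_add₀ hq, Pi.add_apply]
    congr 2
    push_cast
    ring
  have e₂ : q ^ (1 - (p r : ℤ)) / (q ^ (-(p s : ℤ)) * (x r / x s)) =
      q * (qScale q x p s / qScale q x p r) := by
    rw [zpow_sub₀ hq, zpow_one, zpow_neg, zpow_natCast, zpow_natCast]
    simp only [qScale]
    field_simp
  have e₃ : q / (q ^ (-(p s : ℤ)) * (x r / x s)) = q * (x s / x r) * q ^ p s := by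
    rw [zpow_neg, zpow_natCast]
    field_simp
  rwa [e₁, e₂, e₃] at key

/-- The part depending on `x` of the summand of the inversion relation. -/
noncomputable def invFactor (q : ℂ) (x : Fin n → ℂ) (N p k : Fin n → ℕ) : ℂ :=
  vdm q x k * (yFactor q x (qPoint q N) k / ∏ r, ∏ s, qPoch q (q * (x r / x s)) (k r)) *
    ∏ r, ∏ s, qPoch q (q ^ (-(k s : ℤ)) * (x r / x s)) (p r)

/-- The power `q^((|p|+|M|)|l|)` from `yFactor` loses `q^(|p||l|)` to `prod_qPoch_exchange`; the
rest is the `q`-binomial summand at base `x q^p` with `a_s = q^(-M_s)`. -/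
theorem invFactor_add (h : IsGeneric q x) (p M l : Fin n → ℕ) :
    invFactor q x (p + M) p (p + l) = invFactor q x (p + M) p p *
      (fundTerm q (qScale q x p) (fun s => q ^ (-(M s : ℤ))) l * q ^ (wt M * wt l)) := by
  have h₁ := prod_qPoch_exchange h p l
  have h₂ : ∏ r, ∏ s, qPoch q (q * (x r / x s)) ((p + l : Fin n → ℕ) r) =
      (∏ r, ∏ s, qPoch q (q * (x r / x s)) (p r)) *
        ∏ r, ∏ s, qPoch q (q * (x r / x s) * q ^ p r) (l r) := by
    simp only [← prod_mul_distrib]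
    exact prod_congr rfl fun r _ => prod_congr rfl fun s _ => qPoch_add _ _ _ _
  have n₁ : ∏ r, ∏ s, qPoch q (q * (x r / x s)) (p r) ≠ 0 :=
    prod_ne_zero_iff.2 fun r _ => prod_ne_zero_iff.2 fun s _ => h.qPoch_ne_zero r s _
  have n₂ : ∏ r, ∏ s, qPoch q (q * (x r / x s) * q ^ p r) (l r) ≠ 0 := by
    refine right_ne_zero_of_mul (a := ∏ r, ∏ s, qPoch q (q * (x r / x s)) (p r)) ?_
    rw [← h₂]
    exact prod_ne_zero_iff.2 fun r _ => prod_ne_zero_iff.2 fun s _ => h.qPoch_ne_zero r s _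
  have n₃ : ∏ r, ∏ s, qPoch q (q * (qScale q x p r / qScale q x p s)) (l r) ≠ 0 :=
    prod_ne_zero_iff.2 fun r _ => prod_ne_zero_iff.2 fun s _ => (h.scale p).qPoch_ne_zero r s _
  rw [invFactor, invFactor, fundTerm, vdm_add h, yFactor_qPoint_add h, h₂]
  simp only [prod_div_distrib]
  rw [wt_add, add_mul, pow_add, mul_comm (wt p)]
  generalize ∏ r, ∏ s, qPoch q (q * (x r / x s)) (p r) = a₁ at *
  generalize ∏ r, ∏ s, qPoch q (q * (x r / x s) * q ^ p r) (l r) = a₂ at *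
  generalize ∏ r, ∏ s, qPoch q (q * (qScale q x p r / qScale q x p s)) (l r) = a₃ at *
  generalize ∏ r, ∏ s, qPoch q (q ^ (-((p + l : Fin n → ℕ) s : ℤ)) * (x r / x s)) (p r) = a₄ at *
  generalize ∏ r, ∏ s, qPoch q (q ^ (-(p s : ℤ)) * (x r / x s)) (p r) = a₅ at *
  generalize ∏ r, ∏ s, qPoch q (q ^ (-(M s : ℤ)) * (qScale q x p r / qScale q x p s)) (l r) = a₆
  generalize yFactor q x (qPoint q (p + M)) p = a₇
  field_simp
  linear_combination vdm q x p * vdm q (qScale q x p) l * q ^ (wt l * wt M) * a₇ * a₆ * h₁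

/-- The part depending on `a` of the summand of the inversion relation. -/
noncomputable def invWeight (q a : ℂ) (N p k : ℕ) : ℂ :=
  (1 - a * q ^ (2 * k)) * qPoch q a k / ((1 - a) * qPoch q (a * q * q ^ N) k) *
    (qPoch q (a * q ^ k) p / qPoch q (a * q) p)

/-- Companion of `invFactor_add`: the shift by `p` turns the very-well-poised weight for `a` into
the one for `a q^(2p)`. -/
theorem invWeight_add {a : ℂ} (ha : ∀ i : ℕ, a * q ^ i ≠ 1) (p M l : ℕ) :
    invWeight q a (p + M) p (p + l) = invWeight q a (p + M) p p *
      ((1 - a * q ^ (2 * p) * q ^ (2 * l)) * qPoch q (a * q ^ (2 * p)) l /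
        ((1 - a * q ^ (2 * p)) * qPoch q (a * q ^ (2 * p) * q ^ (1 + M)) l)) := by
  have h₁ : qPoch q a (p + l) * qPoch q (a * q ^ (p + l)) p =
      qPoch q a p * qPoch q (a * q ^ p) p * qPoch q (a * q ^ (2 * p)) l := by
    rw [← qPoch_add, ← qPoch_add, two_mul, ← qPoch_add]
    congr 1
    ring
  have h₂ : qPoch q (a * q * q ^ (p + M)) (p + l) =
      qPoch q (a * q * q ^ (p + M)) p * qPoch q (a * q ^ (2 * p) * q ^ (1 + M)) l := by
    rw [qPoch_add]
    congr 2
    ring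
  have hsh : ∀ (j k : ℕ), qPoch q (a * q ^ j) k ≠ 0 := fun j k =>
    qPoch_ne_zero (fun i => by rw [mul_assoc, ← pow_add]; exact ha _) k
  have n₁ : qPoch q (a * q) p ≠ 0 := by simpa using hsh 1 p
  have n₂ : qPoch q (a * q * q ^ (p + M)) p ≠ 0 := by
    rw [mul_assoc, ← pow_succ']; exact hsh _ _
  have n₃ : qPoch q (a * q ^ (2 * p) * q ^ (1 + M)) l ≠ 0 := by
    rw [mul_assoc, ← pow_add]; exact hsh _ _
  have n₄ : 1 - a ≠ 0 := sub_ne_zero.2 (by simpa using (ha 0).symm)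
  have n₅ : 1 - a * q ^ (2 * p) ≠ 0 := sub_ne_zero.2 (ha _).symm
  have e : a * q ^ (2 * (p + l)) = a * q ^ (2 * p) * q ^ (2 * l) := by ring
  rw [invWeight, invWeight, h₂, e]
  field_simp
  linear_combination (1 - a * q ^ (2 * p) * q ^ (2 * l)) * h₁

/-- The inversion relation. -/
theorem sum_inversion (h : IsGeneric q x) {a : ℂ} (ha : ∀ i : ℕ, a * q ^ i ≠ 1)
    (p M : Fin n → ℕ) :
    ∑ l ∈ Icc 0 M, invFactor q x (p + M) p (p + l) *
        invWeight q a (wt (p + M)) (wt p) (wt (p + l)) =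
      if M = 0 then invFactor q x p p p * invWeight q a (wt p) (wt p) (wt p) else 0 := by
  have key := sum_fundTerm_wellPoised (h.scale p) (A := a * q ^ (2 * wt p))
    (fun i => by rw [mul_assoc, ← pow_add]; exact ha _) M
  have : ∀ l, invFactor q x (p + M) p (p + l) *
        invWeight q a (wt (p + M)) (wt p) (wt (p + l)) =
      invFactor q x (p + M) p p * invWeight q a (wt (p + M)) (wt p) (wt p) *
      (fundTerm q (qScale q x p) (fun s => q ^ (-(M s : ℤ))) l *
        ((1 - a * q ^ (2 * wt p) * q ^ (2 * wt l)) * qPoch q (a * q ^ (2 * wt p)) (wt l) /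
          ((1 - a * q ^ (2 * wt p)) * qPoch q (a * q ^ (2 * wt p) * q ^ (1 + wt M)) (wt l))) *
          q ^ (wt M * wt l)) := fun l => by
    rw [invFactor_add h, wt_add, wt_add, invWeight_add ha]
    ring
  simp only [this]
  rw [← mul_sum, key]
  split_ifs with hM
  · rw [hM, add_zero, mul_one]
  · rw [mul_zero]

end Inversion

/-! ### Evaluation of the diagonal entries -/

section Diagonal

variable {n : ℕ} {q : ℂ} {x : Fin n → ℂ}

theorem prod_prod_eq_diag_mul {M : Type*} [CommMonoid M] (f : Fin n → Fin n → M) :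
    ∏ r, ∏ s, f r s = (∏ r, f r r) * ∏ r, ∏ s ∈ Ioi r, (f r s * f s r) := by
  have h := prod_prod_Ioi_mul_eq_prod_prod_off_diag (fun r s => f s r)
  rw [h, ← prod_mul_distrib]
  refine prod_congr rfl fun r _ => ?_
  rw [Fintype.prod_eq_mul_prod_compl r]

theorem two_mul_succ_choose_two (m : ℕ) : 2 * (m + 1).choose 2 = m * m + m := by
  have h : ((2 * (m + 1).choose 2 : ℕ) : ℚ) = ((m * m + m : ℕ) : ℚ) := by
    push_cast [Nat.cast_choose_two]
    ring
  exact_mod_cast h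

theorem succ_choose_two_wt (M : Fin n → ℕ) :
    (wt M + 1).choose 2 = ∑ r, (M r + 1).choose 2 + ∑ r, ∑ s ∈ Ioi r, M r * M s := by
  -- Writing `ℕ` multiplicatively turns the product splitting into the expansion of `(∑ M_r)²`.
  have h₁ := prod_prod_eq_diag_mul (fun r s => Multiplicative.ofAdd (M r * M s))
  simp only [← ofAdd_add, ← ofAdd_sum] at h₁
  have h₂ := Multiplicative.ofAdd.injective h₁
  rw [← sum_mul_sum] at h₂
  have h₃ : ∑ r, 2 * (M r + 1).choose 2 = ∑ r, (M r * M r + M r) :=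
    sum_congr rfl fun r _ => two_mul_succ_choose_two _
  rw [← mul_sum, sum_add_distrib] at h₃
  have h₄ : ∑ r, ∑ s ∈ Ioi r, (M r * M s + M s * M r) = 2 * ∑ r, ∑ s ∈ Ioi r, M r * M s := by
    simp only [mul_sum]
    exact sum_congr rfl fun r _ => sum_congr rfl fun s _ => by ring
  have h₅ := two_mul_succ_choose_two (wt M)
  rw [h₄] at h₂
  unfold wt at h₅ ⊢
  linarith

theorem qShift_eq_prod (q : ℂ) (M : Fin n → ℕ) : qShift q M = ∏ r : Fin n, ∏ s ∈ Ioi r, q ^ M s := by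
  rw [prod_comm' (t' := univ) (s' := fun s => Iio s) (by simp)]
  simp only [prod_const, Fin.card_Iio, qShift, ← prod_pow_eq_pow_sum, ← pow_mul, mul_comm]

theorem qShiftSucc_eq (q : ℂ) (M : Fin n → ℕ) : qShiftSucc q M = qShift q M * q ^ wt M := by
  rw [qShiftSucc, qShift, wt, ← pow_add, ← sum_add_distrib]
  simp only [add_mul, one_mul]

theorem qShiftSucc_add (q : ℂ) (p l : Fin n → ℕ) :
    qShiftSucc q (p + l) = qShiftSucc q p * qShiftSucc q l := by
  rw [qShiftSucc_eq, qShiftSucc_eq, qShiftSucc_eq, qShift_add, wt_add, pow_add]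
  ring

/-- Reversal of all factors of `∏ r, ∏ s, (q x_r / x_s)_{M_r}`. -/
theorem prod_qPoch_reverse (h : IsGeneric q x) (M : Fin n → ℕ) :
    ∏ r, ∏ s, qPoch q (q * (x r / x s)) (M r) =
      vdm q x M * (∏ r, ∏ s, qPoch q (q ^ (-(M s : ℤ)) * (x r / x s)) (M r)) *
        ((-1) ^ wt M * q ^ (wt M + 1).choose 2) := by
  have hq := h.q_ne
  have hdiag : ∏ r, qPoch q (q * (x r / x r)) (M r) =
      (∏ r, qPoch q (q ^ (-(M r : ℤ)) * (x r / x r)) (M r)) *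
        ((-1) ^ wt M * ∏ r, q ^ (M r + 1).choose 2) := by
    rw [wt, ← prod_pow_eq_pow_sum, ← prod_mul_distrib, ← prod_mul_distrib]
    refine prod_congr rfl fun r _ => ?_
    have := qPoch_reverse hq one_ne_zero (M r)
    rw [div_self (h.x_ne r)]
    rw [one_pow, mul_one, div_one] at this
    have h1 : ((-1 : ℂ) ^ M r) * (-1) ^ M r = 1 := by rw [← mul_pow]; norm_num
    rw [mul_one, mul_one] at *
    linear_combination (-(-1 : ℂ) ^ M r) * this - qPoch q q (M r) * h1
  have hoff : ∏ r : Fin n, ∏ s ∈ Ioi r,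
        (qPoch q (q * (x r / x s)) (M r) * qPoch q (q * (x s / x r)) (M s)) =
      vandermonde q x M * qShift q M * (∏ r : Fin n, ∏ s ∈ Ioi r,
        (qPoch q (q ^ (-(M s : ℤ)) * (x r / x s)) (M r) *
          qPoch q (q ^ (-(M r : ℤ)) * (x s / x r)) (M s))) *
        ∏ r : Fin n, ∏ s ∈ Ioi r, q ^ (M r * M s) := by
    rw [qShift_eq_prod, vandermonde]
    simp only [← prod_mul_distrib]
    refine prod_congr rfl fun r _ => prod_congr rfl fun s hs => ?_
    have hrs : r ≠ s := (mem_Ioi.1 hs).ne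
    have ht : x r / x s ≠ 0 := div_ne_zero (h.x_ne r) (h.x_ne s)
    -- The extra factor in length `M_r + 1`, peeled off at the end on one side and at the start on
    -- the other, supplies numerator and denominator of the Vandermonde factor.
    have key := qPoch_exchange hq ht (M s) (M r + 1)
    have e₁ : q ^ (1 - ((M r + 1 : ℕ) : ℤ)) / (x r / x s) = q ^ (-(M r : ℤ)) * (x s / x r) := by
      push_cast
      rw [sub_add_cancel_right, div_eq_mul_inv, inv_div]
    have e₂ : q / (x r / x s) = q * (x s / x r) := by rw [div_eq_mul_inv, inv_div]
    have e₃ : q ^ (-(M s : ℤ)) * (x r / x s) * q ^ M r =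
        q ^ ((M r : ℤ) - (M s : ℤ)) * (x r / x s) := by
      rw [zpow_sub₀ hq, zpow_neg, zpow_natCast, zpow_natCast]
      field_simp
    rw [qPoch_succ, qPoch_succ', e₁, e₂, e₃, mul_comm (x r / x s) q] at key
    have := h.one_sub_ne hrs
    have e₄ : ∀ c : ℂ, c / (1 - x r / x s) = c * (1 - x r / x s)⁻¹ := fun c => div_eq_mul_inv _ _
    have e₅ := mul_inv_cancel₀ this
    rw [e₄]
    generalize (1 - x r / x s)⁻¹ = d at *
    generalize 1 - x r / x s = c at *
    rw [mul_add, mul_one, pow_add] at key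
    rw [mul_comm (M r) (M s)]
    linear_combination (-d) * key - qPoch q (q * (x r / x s)) (M r) *
      qPoch q (q * (x s / x r)) (M s) * e₅
  rw [prod_prod_eq_diag_mul, hdiag, hoff,
    prod_prod_eq_diag_mul (fun r s => qPoch q (q ^ (-(M s : ℤ)) * (x r / x s)) (M r)),
    succ_choose_two_wt, pow_add, vdm]
  simp only [← prod_pow_eq_pow_sum]
  ring

/-- Reversing the last product at base `x q^j` yields exactly the factors by which `vdm` and
`yFactor` grow from `j` to `j + M`. -/
theorem vdm_mul_yFactor (h : IsGeneric q x) (j M : Fin n → ℕ) :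
    q ^ (wt (j + M)).choose 2 * (vdm q x j * yFactor q x (qPoint q (j + M)) j *
      ∏ r, ∏ s, qPoch q (q ^ (1 + (j r : ℤ) - (j s : ℤ)) * (x r / x s)) (M r)) =
      vdm q x (j + M) * yFactor q x (qPoint q (j + M)) (j + M) *
        ((-1) ^ wt M * q ^ (wt j).choose 2) := by
  have e : ∀ r s, q ^ (1 + (j r : ℤ) - (j s : ℤ)) * (x r / x s) =
      q * (qScale q x j r / qScale q x j s) := fun r s => by
    rw [qScale_ratio h.q_ne, ← mul_assoc, ← zpow_one_add₀ h.q_ne, add_sub_assoc]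
  simp only [e]
  rw [prod_qPoch_reverse (h.scale j), yFactor_qPoint_add h, vdm_add h]
  have hexp : (wt (j + M)).choose 2 + (wt M + 1).choose 2 =
      wt (j + M) * wt M + (wt j).choose 2 := by
    have hc : ∀ m : ℕ, 2 * m.choose 2 + m = m * m := fun m => by
      have := two_mul_succ_choose_two m
      have h' := Nat.choose_succ_succ' m 1
      rw [Nat.choose_one_right, one_add_one_eq_two] at h'
      omega
    have h₁ := hc (wt (j + M))
    have h₂ := hc (wt j)
    have h₃ := two_mul_succ_choose_two (wt M)
    rw [wt_add] at h₁ ⊢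
    nlinarith
  have hpow : q ^ (wt (j + M)).choose 2 * q ^ (wt M + 1).choose 2 =
      q ^ (wt (j + M) * wt M) * q ^ (wt j).choose 2 := by
    rw [← pow_add, ← pow_add, hexp]
  generalize ∏ r, ∏ s, qPoch q (q ^ (-(M s : ℤ)) * (qScale q x j r / qScale q x j s)) (M r) = X
  linear_combination vdm q x j * yFactor q x (qPoint q (j + M)) j * vdm q (qScale q x j) M *
    X * (-1) ^ wt M * hpow

theorem invWeight_self {a : ℂ} (ha : ∀ i : ℕ, a * q ^ i ≠ 1) (N : ℕ) :
    invWeight q a N N N = 1 := by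
  have h₁ : qPoch q a (2 * N + 1) = qPoch q a N * qPoch q (a * q ^ N) N * (1 - a * q ^ (2 * N)) := by
    rw [qPoch_succ, two_mul, qPoch_add]
  have h₂ : qPoch q a (2 * N + 1) = (1 - a) * (qPoch q (a * q) N * qPoch q (a * q * q ^ N) N) := by
    rw [qPoch_succ', two_mul, qPoch_add]
  have h₀ := qPoch_ne_zero ha (2 * N + 1)
  rw [h₂] at h₀
  have n₁ := left_ne_zero_of_mul h₀
  have n₂ := left_ne_zero_of_mul (right_ne_zero_of_mul h₀)
  have n₃ := right_ne_zero_of_mul (right_ne_zero_of_mul h₀)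
  rw [h₁] at h₂
  rw [invWeight]
  field_simp
  linear_combination h₂

/-- Both sides come from factoring `(b)_{2j+1+M}` in two ways. -/
theorem qPoch_quotient {b : ℂ} (hb : ∀ i : ℕ, b * q ^ i ≠ 1) (j M : ℕ) :
    qPoch q (b * q) j * qPoch q (b * q ^ (1 + j)) M /
        (qPoch q b (2 * j) * qPoch q (b * q ^ (2 * j + 1)) M) =
      (1 - b * q ^ (2 * j)) / ((1 - b) * qPoch q (b * q * q ^ (j + M)) j) := by
  have h₁ : qPoch q b (2 * j + 1 + M) =
      qPoch q b (2 * j) * (1 - b * q ^ (2 * j)) * qPoch q (b * q ^ (2 * j + 1)) M := by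
    rw [qPoch_add, qPoch_succ]
  have h₂ : qPoch q b (2 * j + 1 + M) = (1 - b) * (qPoch q (b * q) j *
      qPoch q (b * q ^ (1 + j)) M * qPoch q (b * q * q ^ (j + M)) j) := by
    rw [show 2 * j + 1 + M = j + M + j + 1 by ring, qPoch_succ', qPoch_add, qPoch_add]
    congr 4
    ring
  have h₀ := qPoch_ne_zero hb (2 * j + 1 + M)
  have h₀' := h₀
  rw [h₁] at h₀
  rw [h₂] at h₀'
  have n₁ := left_ne_zero_of_mul (left_ne_zero_of_mul h₀)
  have n₂ := right_ne_zero_of_mul h₀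
  have n₃ := left_ne_zero_of_mul h₀'
  have n₄ := right_ne_zero_of_mul (right_ne_zero_of_mul h₀')
  rw [h₁] at h₂
  field_simp
  linear_combination -h₂

/-- The diagonal entry is not `1`: combined with the `x`-part of `coreTerm` at `m = M`, it gives the
`x`-part of `lhsTerm`. -/
theorem invFactor_self (h : IsGeneric q x) (j M : Fin n → ℕ) :
    invFactor q x (j + M) (j + M) (j + M) * vandermonde q x (j + M) *
      ((-1) ^ wt j * qShiftSucc q (j + M) * q ^ (wt j).choose 2 /
        ∏ r, ∏ s, qPoch q (q ^ (1 + (j r : ℤ) - (j s : ℤ)) * (x r / x s)) (M r)) =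
      vdm q x j * yFactor q x (qPoint q (j + M)) j := by
  have h₁ := prod_qPoch_reverse h (j + M)
  have h₂ := vdm_mul_yFactor h j M
  have n₁ : ∏ r, ∏ s, qPoch q (q * (x r / x s)) ((j + M : Fin n → ℕ) r) ≠ 0 :=
    prod_ne_zero_iff.2 fun r _ => prod_ne_zero_iff.2 fun s _ => h.qPoch_ne_zero r s _
  have n₂ : ∏ r, ∏ s, qPoch q (q ^ (1 + (j r : ℤ) - (j s : ℤ)) * (x r / x s)) (M r) ≠ 0 := by
    refine prod_ne_zero_iff.2 fun r _ => prod_ne_zero_iff.2 fun s _ => ?_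
    have := (h.scale j).qPoch_ne_zero r s (M r)
    rwa [qScale_ratio h.q_ne, ← mul_assoc, ← zpow_one_add₀ h.q_ne, ← add_sub_assoc] at this
  rw [invFactor, qShiftSucc_eq]
  rw [Nat.choose_succ_succ' (wt (j + M)) 1, Nat.choose_one_right, pow_add] at h₁
  have hv : vandermonde q x (j + M) * qShift q (j + M) = vdm q x (j + M) := rfl
  have hs : (-1 : ℂ) ^ wt (j + M) * (-1) ^ wt M = (-1) ^ wt j := by
    rw [wt_add, pow_add, mul_assoc, ← mul_pow]
    norm_num
  generalize ∏ r, ∏ s, qPoch q (q * (x r / x s)) ((j + M : Fin n → ℕ) r) = Q at *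
  generalize ∏ r, ∏ s, qPoch q (q ^ (1 + (j r : ℤ) - (j s : ℤ)) * (x r / x s)) (M r) = Z at *
  generalize ∏ r, ∏ s, qPoch q (q ^ (-((j + M : Fin n → ℕ) s : ℤ)) * (x r / x s))
    ((j + M : Fin n → ℕ) r) = X at *
  generalize vdm q x (j + M) = V at *
  generalize vandermonde q x (j + M) = W at *
  generalize qShift q (j + M) = S at *
  generalize yFactor q x (qPoint q (j + M)) (j + M) = Y at *
  field_simp
  linear_combination V * Y * X * q ^ wt (j + M) * q ^ (wt j).choose 2 * (-1) ^ wt j * hv -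
    V ^ 2 * Y * X * q ^ wt (j + M) * q ^ (wt j).choose 2 * hs -
    V * X * (-1) ^ wt (j + M) * q ^ wt (j + M) * h₂ -
    vdm q x j * yFactor q x (qPoint q (j + M)) j * Z * h₁

end Diagonal

/-! ### The identity at `y = q^N` -/

section TerminatingCase

variable {n : ℕ} {q : ℂ} {x : Fin n → ℂ}

theorem sum_Icc_sum_Icc (N : Fin n → ℕ) (f : (Fin n → ℕ) → (Fin n → ℕ) → ℂ) :
    ∑ k ∈ Icc 0 N, ∑ j ∈ Icc 0 k, f k j =
      ∑ j ∈ Icc 0 N, ∑ l ∈ Icc 0 (N - j), f (j + l) j := by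
  rw [sum_comm' (t' := Icc 0 N) (s' := fun j => Icc j N)]
  · refine sum_congr rfl fun j hj => ?_
    have hjN := (mem_Icc.1 hj).2
    refine sum_nbij' (fun k => k - j) (fun l => j + l) ?_ ?_ ?_ ?_ ?_
    · intro k hk
      exact mem_Icc.2 ⟨fun _ => Nat.zero_le _, tsub_le_tsub_right (mem_Icc.1 hk).2 j⟩
    · intro l hl
      exact mem_Icc.2 ⟨le_self_add, (le_tsub_iff_left hjN).1 (mem_Icc.1 hl).2⟩
    · intro k hk
      exact add_tsub_cancel_of_le (mem_Icc.1 hk).1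
    · intro l _
      exact add_tsub_cancel_left j l
    · intro k hk
      rw [add_tsub_cancel_of_le (mem_Icc.1 hk).1]
  · intro k j
    simp only [mem_Icc]
    constructor
    · rintro ⟨⟨_, h₂⟩, h₃, h₄⟩
      exact ⟨⟨h₄, h₂⟩, h₃, h₄.trans h₂⟩
    · rintro ⟨⟨h₁, h₂⟩, h₃, _⟩
      exact ⟨⟨h₃.trans h₁, h₂⟩, h₃, h₁⟩

/-- The part of the summand of the right-hand side that does not depend on the index `k` of the
outer sum once `j + m` is fixed. -/
noncomputable def coreTerm (q : ℂ) (x : Fin n → ℂ) (b : ℂ) (K : (Fin n → ℂ) → ℂ)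
    (β : (Fin n → ℕ) → ℂ) (j m : Fin n → ℕ) : ℂ :=
  K (qPoint q (j + m)) * vandermonde q x (j + m) *
    ((-1) ^ wt j * qShiftSucc q (j + m) * q ^ (wt j).choose 2 /
      ∏ r, ∏ s, qPoch q (q ^ (1 + (j r : ℤ) - (j s : ℤ)) * (x r / x s)) (m r)) *
    (qPoch q (b * q) (wt j) * qPoch q (b * q ^ (1 + wt j)) (wt m) /
      (qPoch q b (2 * wt j) * qPoch q (b * q ^ (2 * wt j + 1)) (wt m))) * β j

theorem rhsTerm_qPoint (h : IsGeneric q x) (a b : ℂ) (K : (Fin n → ℂ) → ℂ)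
    (β : (Fin n → ℕ) → ℂ) (N k : Fin n → ℕ) :
    rhsTerm q x a b K β (qPoint q N) k =
      ∑ j ∈ Icc 0 k, ∑ m ∈ Icc 0 (k - j), invFactor q x N (j + m) k *
        invWeight q a (wt N) (wt (j + m)) (wt k) * coreTerm q x b K β j m := by
  rw [rhsTerm, middleSum, mul_sum]
  refine sum_congr rfl fun j _ => ?_
  rw [innerSum, mul_sum, mul_sum]
  refine sum_congr rfl fun m _ => ?_
  have hq := h.q_ne
  have h₁ : vandermonde q x j * ∏ r : Fin n, ∏ s ∈ Ioi r,
      (1 - q ^ ((m r : ℤ) - (m s : ℤ) + (j r : ℤ) - (j s : ℤ)) * (x r / x s)) /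
        (1 - q ^ ((j r : ℤ) - (j s : ℤ)) * (x r / x s)) = vandermonde q x (j + m) := by
    rw [← vandermonde_ratio h j (j + m)]
    congr 1
    refine prod_congr rfl fun r _ => prod_congr rfl fun s _ => ?_
    congr 4
    simp only [Pi.add_apply]
    push_cast
    ring
  have h₂ : (∏ r, ∏ s, qPoch q (q ^ (-(k s : ℤ)) * (x r / x s)) (j r)) *
      (∏ r, ∏ s, qPoch q (q ^ (-(k s : ℤ) + (j r : ℤ)) * (x r / x s)) (m r)) =
      ∏ r, ∏ s, qPoch q (q ^ (-(k s : ℤ)) * (x r / x s)) ((j + m : Fin n → ℕ) r) := by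
    simp only [← prod_mul_distrib]
    refine prod_congr rfl fun r _ => prod_congr rfl fun s _ => ?_
    rw [Pi.add_apply, qPoch_add, zpow_add₀ hq, zpow_natCast]
    congr 2
    ring
  have h₃ : qPoch q (a * q ^ wt k) (wt j) * qPoch q (a * q ^ (wt k + wt j)) (wt m) =
      qPoch q (a * q ^ wt k) (wt (j + m)) := by
    rw [wt_add, qPoch_add, pow_add, mul_assoc]
  have h₄ : ∏ r, ∏ s, qPoch q (q ^ (-(k s : ℤ) + (j r : ℤ)) * (x r / x s)) (m r) /
      qPoch q (q ^ (1 + (j r : ℤ) - (j s : ℤ)) * (x r / x s)) (m r) =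
      (∏ r, ∏ s, qPoch q (q ^ (-(k s : ℤ) + (j r : ℤ)) * (x r / x s)) (m r)) /
        ∏ r, ∏ s, qPoch q (q ^ (1 + (j r : ℤ) - (j s : ℤ)) * (x r / x s)) (m r) := by
    simp only [prod_div_distrib]
  rw [coreTerm, invFactor, invWeight, ← h₁, ← h₂, ← h₃, h₄, prod_qPoint, qShiftSucc_add,
    add_comm m j, add_comm (wt m) (wt j), ← wt_add j m, vdm]
  generalize ∏ r : Fin n, ∏ s ∈ Ioi r,
      (1 - q ^ ((m r : ℤ) - (m s : ℤ) + (j r : ℤ) - (j s : ℤ)) * (x r / x s)) /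
        (1 - q ^ ((j r : ℤ) - (j s : ℤ)) * (x r / x s)) = c₁
  generalize ∏ r, ∏ s, qPoch q (q ^ (1 + (j r : ℤ) - (j s : ℤ)) * (x r / x s)) (m r) = c₂
  generalize ∏ r, ∏ s, qPoch q (q ^ (-(k s : ℤ) + (j r : ℤ)) * (x r / x s)) (m r) = c₃
  generalize ∏ r, ∏ s, qPoch q (q ^ (-(k s : ℤ)) * (x r / x s)) (j r) = c₄
  generalize ∏ r, ∏ s, qPoch q (q * (x r / x s)) (k r) = c₅
  simp only [div_eq_mul_inv, mul_inv]
  ring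

theorem sum_rhsTerm_qPoint (h : IsGeneric q x) {a b : ℂ} (ha : ∀ i : ℕ, a * q ^ i ≠ 1)
    (hb : ∀ i : ℕ, b * q ^ i ≠ 1) (K : (Fin n → ℂ) → ℂ) (β : (Fin n → ℕ) → ℂ)
    (N : Fin n → ℕ) :
    ∑ k ∈ Icc 0 N, rhsTerm q x a b K β (qPoint q N) k =
      K (qPoint q N) * ∑ j ∈ Icc 0 N, lhsTerm q x b β (qPoint q N) j := by
  simp only [rhsTerm_qPoint h]
  rw [sum_Icc_sum_Icc, mul_sum]
  refine sum_congr rfl fun j hj => ?_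
  have hjN := (mem_Icc.1 hj).2
  simp only [add_tsub_cancel_left]
  -- With `j` fixed and `k` shifted by `j`, the second exchange brings the sum over `k` inside the
  -- sum over `m`.
  rw [sum_Icc_sum_Icc]
  obtain ⟨M, rfl⟩ := exists_add_of_le hjN
  rw [add_tsub_cancel_left]
  have key : ∀ m ∈ Icc 0 M, (∑ l ∈ Icc 0 (M - m), invFactor q x (j + M) (j + m) (j + (m + l)) *
      invWeight q a (wt (j + M)) (wt (j + m)) (wt (j + (m + l))) * coreTerm q x b K β j m) =
      if m = M then invFactor q x (j + M) (j + M) (j + M) * coreTerm q x b K β j M else 0 := by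
    intro m hm
    obtain ⟨D, rfl⟩ := exists_add_of_le (mem_Icc.1 hm).2
    rw [← sum_mul]
    simp only [add_tsub_cancel_left, ← add_assoc]
    rw [sum_inversion h ha (j + m) D, invWeight_self ha, mul_one]
    by_cases hD : D = 0
    · subst hD
      simp
    · rw [if_neg hD, if_neg (by simpa using hD), zero_mul]
  rw [sum_congr rfl key, sum_ite_eq' (Icc 0 M) M]
  rw [if_pos (mem_Icc.2 ⟨fun _ => Nat.zero_le _, le_rfl⟩)]
  have h₁ := invFactor_self h j M
  have h₂ := qPoch_quotient hb (wt j) (wt M)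
  rw [coreTerm, lhsTerm, prod_qPoint, h₂, wt_add]
  rw [vdm] at h₁
  linear_combination K (qPoint q (j + M)) * ((1 - b * q ^ (2 * wt j)) /
    ((1 - b) * qPoch q (b * q * q ^ (wt j + wt M)) (wt j))) * β j * h₁

theorem lhsTerm_qPoint_eq_zero (h : IsGeneric q x) (b : ℂ) (β : (Fin n → ℕ) → ℂ)
    {N j : Fin n → ℕ} (hj : ¬ j ≤ N) : lhsTerm q x b β (qPoint q N) j = 0 := by
  simp [lhsTerm, yFactor_qPoint_eq_zero h hj]

theorem rhsTerm_qPoint_eq_zero (h : IsGeneric q x) (a b : ℂ) (K : (Fin n → ℂ) → ℂ)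
    (β : (Fin n → ℕ) → ℂ) {N k : Fin n → ℕ} (hk : ¬ k ≤ N) :
    rhsTerm q x a b K β (qPoint q N) k = 0 := by
  simp [rhsTerm, yFactor_qPoint_eq_zero h hk]

theorem tsum_qPoint (h : IsGeneric q x) {a b : ℂ} (ha : ∀ i : ℕ, a * q ^ i ≠ 1)
    (hb : ∀ i : ℕ, b * q ^ i ≠ 1) (K : (Fin n → ℂ) → ℂ) (β : (Fin n → ℕ) → ℂ)
    (N : Fin n → ℕ) :
    K (qPoint q N) * ∑' j, lhsTerm q x b β (qPoint q N) j =
      ∑' k, rhsTerm q x a b K β (qPoint q N) k := by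
  have hmem : ∀ k, k ∉ Icc 0 N → ¬ k ≤ N := fun k hk hkN =>
    hk (mem_Icc.2 ⟨fun _ => Nat.zero_le _, hkN⟩)
  rw [tsum_eq_sum fun j hj => lhsTerm_qPoint_eq_zero h b β (hmem j hj),
    tsum_eq_sum fun k hk => rhsTerm_qPoint_eq_zero h a b K β (hmem k hk),
    sum_rhsTerm_qPoint h ha hb]

end TerminatingCase

/-! ### Passage from the points `q^N` to the polydisc -/

section IdentityTheorem

open Filter Topology

variable {n : ℕ} {q : ℂ}

/-- An analytic function on a polydisc around the origin that vanishes at the points `q^N` in it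
is zero. -/
theorem eq_zero_of_qPoint_eq_zero (hq0 : q ≠ 0) (hq1 : ‖q‖ < 1) {R : Fin n → ℝ}
    (hR : ∀ r, 0 < R r) {f : (Fin n → ℂ) → ℂ} (hf : AnalyticOnNhd ℂ f (polydisc R))
    (hfq : ∀ N, qPoint q N ∈ polydisc R → f (qPoint q N) = 0) {y : Fin n → ℂ}
    (hy : y ∈ polydisc R) : f y = 0 := by
  -- Coordinates in `s` are arbitrary and the others are powers of `q`; induction on `s` frees one
  -- coordinate at a time.
  suffices H : ∀ s : Finset (Fin n), ∀ y ∈ polydisc R, (∀ r ∉ s, ∃ N : ℕ, y r = q ^ N) →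
      f y = 0 from H univ y hy fun r hr => absurd (mem_univ r) hr
  intro s
  induction s using Finset.induction_on with
  | empty =>
    intro y hy h
    choose N hN using fun r => h r (notMem_empty r)
    obtain rfl : y = qPoint q N := funext hN
    exact hfq N hy
  | insert r s _ ih =>
    intro y hy h
    have hmem : ∀ t ∈ Metric.ball (0 : ℂ) (R r), Function.update y r t ∈ polydisc R := by
      intro t ht i
      by_cases hi : i = r
      · subst hi
        simpa using ht
      · simpa [Function.update_of_ne hi] using hy i
    have hg : AnalyticOnNhd ℂ (fun t => f (Function.update y r t)) (Metric.ball 0 (R r)) := by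
      refine DifferentiableOn.analyticOnNhd (fun t ht => ?_) Metric.isOpen_ball
      exact ((hf _ (hmem t ht)).differentiableAt.comp t
        (hasFDerivAt_update y t).differentiableAt).differentiableWithinAt
    have hlim : Tendsto (fun N : ℕ => q ^ N) atTop (𝓝 0) :=
      tendsto_pow_atTop_nhds_zero_of_norm_lt_one hq1
    have hev : ∀ᶠ N : ℕ in atTop, f (Function.update y r (q ^ N)) = 0 := by
      filter_upwards [hlim.eventually (Metric.ball_mem_nhds 0 (hR r))] with N hN
      refine ih _ (hmem _ hN) fun i hi => ?_
      by_cases hir : i = r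
      · subst hir
        exact ⟨N, Function.update_self _ _ _⟩
      · rw [Function.update_of_ne hir]
        exact h i (by simp [hir, hi])
    -- As `q ≠ 0`, the zeros `q^N` of the slice approach `0` without reaching it, as the identity
    -- theorem requires.
    have hlim' : Tendsto (fun N : ℕ => q ^ N) atTop (𝓝[≠] 0) :=
      tendsto_nhdsWithin_iff.2 ⟨hlim, Eventually.of_forall fun N => pow_ne_zero N hq0⟩
    have h0 := hg.eqOn_zero_of_preconnected_of_frequently_eq_zero
      (convex_ball _ _).isPreconnected (Metric.mem_ball_self (hR r))
      (hlim'.frequently hev.frequently)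
    have := h0 (show y r ∈ Metric.ball (0 : ℂ) (R r) by simpa using hy r)
    simpa using this

end IdentityTheorem

theorem isGeneric_of {n : ℕ} {q : ℂ} (hq0 : 0 < ‖q‖) (hq1 : ‖q‖ < 1) {x : Fin n → ℂ}
    (hx0 : ∀ r, x r ≠ 0) (hx : ∀ r s, r ≠ s → ∀ i : ℤ, x r / x s ≠ q ^ i) : IsGeneric q x where
  q_ne := norm_pos_iff.1 hq0
  q_pow i hi := by
    have := pow_lt_one₀ (norm_nonneg q) hq1 (Nat.succ_ne_zero i)
    rw [← norm_pow, hi, norm_one] at this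
    exact this.false
  x_ne := hx0
  ratio r s hrs i hi := by
    refine hx r s hrs (-i) ?_
    rw [zpow_neg]
    exact eq_inv_of_mul_eq_one_right hi

end AnSeries

theorem theorem1p2 (n : ℕ) (q : ℂ) (hq0 : 0 < ‖q‖) (hq1 : ‖q‖ < 1)
    (x : Fin n → ℂ) (hx0 : ∀ r, x r ≠ 0)
    (hx : ∀ r s, r ≠ s → ∀ i : ℤ, x r / x s ≠ q ^ i)
    (a b : ℂ) (ha : ∀ i : ℕ, a * q ^ i ≠ 1) (hb : ∀ i : ℕ, b * q ^ i ≠ 1)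
    (K : (Fin n → ℂ) → ℂ) (β : (Fin n → ℕ) → ℂ) :
    -- the terminating case `y_r = q^{N_r}`
    (∀ N : Fin n → ℕ,
      (∀ j, ¬ j ≤ N → AnSeries.lhsTerm q x b β (AnSeries.qPoint q N) j = 0) ∧
      (∀ k, ¬ k ≤ N → AnSeries.rhsTerm q x a b K β (AnSeries.qPoint q N) k = 0) ∧
      K (AnSeries.qPoint q N) * ∑' j, AnSeries.lhsTerm q x b β (AnSeries.qPoint q N) j =
        ∑' k, AnSeries.rhsTerm q x a b K β (AnSeries.qPoint q N) k) ∧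
    -- the analytic case, `y_r` in a disc around the origin
    (∀ R : Fin n → ℝ, (∀ r, 0 < R r) →
      (∀ y ∈ AnSeries.polydisc R, ∀ i : ℕ,
        a * q ^ (i + 1) * ∏ r, y r ≠ 1 ∧ b * q ^ (i + 1) * ∏ r, y r ≠ 1) →
      (∀ y ∈ AnSeries.polydisc R, Summable fun j => ‖AnSeries.lhsTerm q x b β y j‖) →
      (∀ y ∈ AnSeries.polydisc R, Summable fun k => ‖AnSeries.rhsTerm q x a b K β y k‖) →
      AnalyticOnNhd ℂ (fun y => K y * ∑' j, AnSeries.lhsTerm q x b β y j)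
        (AnSeries.polydisc R) →
      AnalyticOnNhd ℂ (fun y => ∑' k, AnSeries.rhsTerm q x a b K β y k)
        (AnSeries.polydisc R) →
      ∀ y ∈ AnSeries.polydisc R,
        K y * ∑' j, AnSeries.lhsTerm q x b β y j =
          ∑' k, AnSeries.rhsTerm q x a b K β y k) := by
  have h := AnSeries.isGeneric_of hq0 hq1 hx0 hx
  refine ⟨fun N => ⟨fun j => AnSeries.lhsTerm_qPoint_eq_zero h b β,
    fun k => AnSeries.rhsTerm_qPoint_eq_zero h a b K β, AnSeries.tsum_qPoint h ha hb K β N⟩, ?_⟩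
  intro R hR _ _ _ hL hRhs y hy
  refine sub_eq_zero.1 (AnSeries.eq_zero_of_qPoint_eq_zero h.q_ne hq1 hR (hL.sub hRhs)
    (fun N _ => ?_) hy)
  exact sub_eq_zero.2 (AnSeries.tsum_qPoint h ha hb K β N)
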